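/- **Model.** In an $n$-node Congested Clique with crash faults, nodes with IDs $1,\dots,n$, all known to everybody, communicate in synchronous rounds. In each round each node may send a message of at most $b$ bits to each other node. If a node crashes in a round, an arbitrary subset, chosen by an adversary, of the messages it sends in that round is lost, and the node is inactive afterwards. All messages sent in a round by a node that has not crashed by the end of that round are delivered. A node that never crashes is called non-faulty. Local computation is unrestricted, nodes may use private coin flips, and the algorithm may depend on $n$, on $b$ and on the bound $f$ on the number of crashes. **Problem.** In *distributed graph realization with faults*, each node $v$ initially knows only its own degree $d_v \in \{0,\dots,n-1\}$ (besides the IDs and its coin flips). An algorithm *solves* the problem with $f$ crash failures if in every admissible execution, that is, for all inputs, all outcomes of the coin flips, and all crashes of at most $f$ nodes, every non-faulty node eventually terminates with an irrevocable output, and there is a set $S$ of nodes that contains every non-faulty node (so $|S| \ge n - |F|$, where $F$ is the set of nodes that crash) with the following property, where $D' = (d_v)_{v\in S}$. If $D'$ is realizable, then there is a graph $G'$ on $S$ in which each $v \in S$ has degree $d_v$, such that every non-faulty node outputs a set of edges of $G'$, and each edge of $G'$ with a non-faulty endpoint is in the output of at least one of its two endpoints. If $D'$ is not realizable, then every non-faulty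 node outputs "unrealizable". **Theorem.** Any algorithm that solves distributed graph realization with faults in an $n$-node Congested Clique with $f \le n-1$ crash failures requires $\Omega(f)$ rounds in some admissible execution. That is, there is an absolute constant $c > 0$ such that for all $n$, all $f < n$, all bandwidths $b$ and every such algorithm there is an admissible execution, with at most $f$ crashes, in which it is not the case that all non-faulty nodes have terminated after fewer than $c f$ rounds. -/

import Mathlib

namespace CrashClique

/-- What a terminated node reports: either the verdict "unrealizable", or the set of those edges of
the overlay graph that the node knows of (possibly all of them, possibly only some). -/
inductive Output (n : ℕ) : Type
  | unrealizable : Output n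
  | overlay (known : Set (Sym2 (Fin n))) : Output n

/-- A message of at most `b` bits. -/
abbrev Msg (b : ℕ) : Type := {w : List Bool // w.length ≤ b}

/-- A synchronous algorithm for the Congested Clique on the nodes `Fin n` with bandwidth `b`.
Nodes know their own ID and the ID behind every link. Local computation is unrestricted and each
node has a private tape of coin flips, which a deterministic algorithm ignores. -/
structure Algorithm (n b : ℕ) where
  /-- local states -/
  State : Type
  /-- initial state of a node, from its ID, its own input degree and its coin tape -/
  init : Fin n → ℕ → (ℕ → Bool) → State
  /-- `send i s j` is the message (if any) that node `i` in state `s` sends to node `j` -/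
  send : Fin n → State → Fin n → Option (Msg b)
  /-- new state of a node, from its old one and the messages received in the round, by sender -/
  step : Fin n → State → (Fin n → Option (Msg b)) → State
  /-- `none` as long as the node has not terminated, afterwards its output -/
  out : Fin n → State → Option (Output n)
  /-- outputs are irrevocable -/
  out_step : ∀ i s m o, out i s = some o → out i (step i s m) = some o

/-- Everything that determines an execution besides the algorithm: the input degrees, the coin
flips, and the choices of the adversary. Rounds are numbered `0, 1, 2, …`. -/
structure Scenario (n : ℕ) where
  /-- input degree of each node -/
  deg : Fin n → ℕ
  /-- coin tape of each node -/
  coins : Fin n → ℕ → Bool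
  /-- the round in which a node crashes, `⊤` if it never does -/
  crashRound : Fin n → ℕ∞
  /-- the nodes that are still reached by the messages a node sends in the round of its crash -/
  reached : Fin n → Set (Fin n)

namespace Scenario

variable {n : ℕ}

/-- The nodes that crash in this execution. -/
def faulty (E : Scenario n) : Set (Fin n) := {i | E.crashRound i ≠ ⊤}

/-- At most `f` nodes crash, and each input is a possible degree in an `n`-node graph. -/
def Admissible (E : Scenario n) (f : ℕ) : Prop :=
  E.faulty.ncard ≤ f ∧ ∀ i, E.deg i < n

/-- Messages sent by `i` to `j` in round `r` arrive: `i` has not crashed by the end of round `r`,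
or it crashes in this very round and the adversary lets the message to `j` pass. -/
def Delivers (E : Scenario n) (r : ℕ) (i j : Fin n) : Prop :=
  (r : ℕ∞) < E.crashRound i ∨ ((r : ℕ∞) = E.crashRound i ∧ j ∈ E.reached i)

end Scenario

variable {n b : ℕ}

open Classical in
/-- `A.state E r i` is the state of node `i` after `r` rounds (rounds `0, …, r - 1`). A node that
crashes does not complete the round of its crash and is inactive afterwards. -/
noncomputable def Algorithm.state (A : Algorithm n b) (E : Scenario n) : ℕ → Fin n → A.State
  | 0, i => A.init i (E.deg i) (E.coins i)
  | r + 1, i =>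
    if (r : ℕ∞) < E.crashRound i then
      A.step i (A.state E r i) fun j =>
        if j ≠ i ∧ E.Delivers r j i then A.send j (A.state E r j) i else none
    else A.state E r i

/-- Node `i` terminates with output `o`. -/
def Algorithm.Outputs (A : Algorithm n b) (E : Scenario n) (i : Fin n) (o : Output n) : Prop :=
  ∃ r, A.out i (A.state E r i) = some o

/-- The execution takes at most `r` rounds: after `r` rounds all non-faulty nodes have
terminated. -/
def Algorithm.TerminatesWithin (A : Algorithm n b) (E : Scenario n) (r : ℕ) : Prop :=
  ∀ i, i ∉ E.faulty → ∃ o, A.out i (A.state E r i) = some o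

/-- Node `i` terminates knowing the edge `e` of the overlay graph. -/
def Algorithm.Knows (A : Algorithm n b) (E : Scenario n) (i : Fin n) (e : Sym2 (Fin n)) : Prop :=
  ∃ K, A.Outputs E i (.overlay K) ∧ e ∈ K

/-- `G` is a graph on the node set `S` in which each `v ∈ S` has degree `d v`. -/
def IsRealization (d : Fin n → ℕ) (S : Set (Fin n)) (G : SimpleGraph (Fin n)) : Prop :=
  (∀ u v, G.Adj u v → u ∈ S ∧ v ∈ S) ∧ ∀ v ∈ S, (G.neighborSet v).ncard = d v

/-- The degrees `d v`, `v ∈ S`, are realizable. -/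
def Realizable (d : Fin n → ℕ) (S : Set (Fin n)) : Prop := ∃ G, IsRealization d S G

/-- The outputs of the execution are correct for distributed graph realization with faults: there is
a sub-sequence `D'` of the input degrees (those of the nodes in `S`), missing only degrees of nodes
that crashed, such that the non-faulty nodes construct a realization of `D'` if there is one and
all output "unrealizable" otherwise. An edge of the overlay graph must be known to one of its
endpoints; nothing is asked about edges both of whose endpoints crash. -/
def Algorithm.CorrectOn (A : Algorithm n b) (E : Scenario n) : Prop :=
  ∃ S : Set (Fin n),
    n ≤ S.ncard + E.faulty.ncard ∧
    Sᶜ ⊆ E.faulty ∧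
    ((∃ G : SimpleGraph (Fin n), IsRealization E.deg S G ∧
        (∀ i, i ∉ E.faulty → ∃ K, A.Outputs E i (.overlay K) ∧ K ⊆ G.edgeSet) ∧
        ∀ u v, G.Adj u v → u ∉ E.faulty → A.Knows E u s(u, v) ∨ A.Knows E v s(u, v)) ∨
      (¬ Realizable E.deg S ∧ ∀ i, i ∉ E.faulty → A.Outputs E i .unrealizable))

/-- `A` solves distributed graph realization with faults in the presence of up to `f` crashes: in
every admissible execution all non-faulty nodes terminate, with correct outputs. -/
def Algorithm.Solves (A : Algorithm n b) (f : ℕ) : Prop :=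
  ∀ E : Scenario n, E.Admissible f → (∃ r, A.TerminatesWithin E r) ∧ A.CorrectOn E

end CrashClique

/-! All non-faulty nodes share one verdict: either all say "unrealizable" or all output edges. If
every execution ended within t < f rounds, two executions that look alike for t rounds to a node
non-faulty in both would have equal verdicts (`Solves.respects`). As in the round lower bound for
consensus, a chain of such executions shows that silencing one more node p from round k on preserves
the verdict (`Respects.crash_iff`). The induction runs down from k = t: the round-k messages of p
are restored one receiver q at a time, and silencing q from round k + 1 on hides the change from
everyone else. Each level costs one crash, hence at most t + 1 ≤ f in all. Without faults, all
degrees 0 is realizable and a single degree 1 at p is not. Silencing p from round 0 hides its input,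
so both verdicts would agree, a contradiction. This gives c = 1. -/

namespace CrashClique

namespace Scenario

/-- The scenario `E`, changed so that node `p` crashes in round `k`, in which its messages reach
only the nodes of `R`. -/
def crash {n : ℕ} (E : Scenario n) (p : Fin n) (k : ℕ) (R : Set (Fin n)) : Scenario n where
  deg := E.deg
  coins := E.coins
  crashRound := Function.update E.crashRound p k
  reached := Function.update E.reached p R

variable {n : ℕ}

lemma crash_crashRound_self (E : Scenario n) (p : Fin n) (k : ℕ) (R : Set (Fin n)) :
    (E.crash p k R).crashRound p = k := by
  simp [crash]

lemma crash_crashRound_of_ne (E : Scenario n) {p i : Fin n} (h : i ≠ p) (k : ℕ)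
    (R : Set (Fin n)) : (E.crash p k R).crashRound i = E.crashRound i := by
  simp [crash, h]

lemma faulty_crash (E : Scenario n) (p : Fin n) (k : ℕ) (R : Set (Fin n)) :
    (E.crash p k R).faulty = insert p E.faulty := by
  ext i
  by_cases h : i = p
  · subst h; simp [faulty, crash]
  · simp [faulty, crash, h]

lemma ncard_faulty_crash_le (E : Scenario n) (p : Fin n) (k : ℕ) (R : Set (Fin n)) :
    (E.crash p k R).faulty.ncard ≤ E.faulty.ncard + 1 := by
  rw [faulty_crash]
  exact Set.ncard_insert_le _ _

lemma delivers_crash_self (E : Scenario n) (p i : Fin n) (k r : ℕ) (R : Set (Fin n)) :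
    (E.crash p k R).Delivers r p i ↔ r < k ∨ (r = k ∧ i ∈ R) := by
  simp [Delivers, crash]

lemma delivers_crash_of_ne (E : Scenario n) {p j : Fin n} (h : j ≠ p) (i : Fin n) (k r : ℕ)
    (R : Set (Fin n)) : (E.crash p k R).Delivers r j i ↔ E.Delivers r j i := by
  simp [Delivers, crash, h]

lemma crashRound_eq_top {E : Scenario n} {i : Fin n} (h : i ∉ E.faulty) :
    E.crashRound i = ⊤ := by
  simpa [faulty] using h

/-- All crashes happen in the first `k` rounds, and there are at most `k` of them. -/
def CrashesBefore (E : Scenario n) (k : ℕ) : Prop :=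
  E.faulty.ncard ≤ k ∧ ∀ i ∈ E.faulty, E.crashRound i < k

lemma CrashesBefore.succ {E : Scenario n} {k : ℕ} (h : E.CrashesBefore k) :
    E.CrashesBefore (k + 1) :=
  ⟨h.1.trans k.le_succ, fun i hi => (h.2 i hi).trans (by exact_mod_cast k.lt_succ_self)⟩

lemma CrashesBefore.crash {E : Scenario n} {k : ℕ} (h : E.CrashesBefore k) (p : Fin n)
    (R : Set (Fin n)) : (E.crash p k R).CrashesBefore (k + 1) := by
  refine ⟨(E.ncard_faulty_crash_le p k R).trans (Nat.succ_le_succ h.1), fun i hi => ?_⟩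
  by_cases hip : i = p
  · subst hip
    rw [crash_crashRound_self]
    exact_mod_cast k.lt_succ_self
  · rw [faulty_crash] at hi
    rw [crash_crashRound_of_ne _ hip]
    exact h.succ.2 i (hi.resolve_left hip)

end Scenario

variable {n b : ℕ}

/-! ### Indistinguishable executions -/

namespace Algorithm

/-- Two executions look the same to all nodes outside `D`, provided that what these nodes receive
comes from nodes outside `D` or from nodes in the same state in both executions. -/
lemma state_congr (A : Algorithm n b) {E E' : Scenario n} (D : Set (Fin n)) (t : ℕ)
    (hdeg : ∀ i, i ∉ D → E.deg i = E'.deg i) (hcoins : ∀ i, i ∉ D → E.coins i = E'.coins i)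
    (hcrash : ∀ r < t, ∀ i, i ∉ D → ((r : ℕ∞) < E.crashRound i ↔ (r : ℕ∞) < E'.crashRound i))
    (hdel : ∀ r < t, ∀ i, i ∉ D → (r : ℕ∞) < E.crashRound i → ∀ j, j ≠ i →
      (E.Delivers r j i ↔ E'.Delivers r j i) ∧
        (E.Delivers r j i → j ∈ D → A.state E r j = A.state E' r j)) :
    ∀ r ≤ t, ∀ i, i ∉ D → A.state E r i = A.state E' r i := by
  intro r
  induction r with
  | zero => intro _ i hi; simp only [state, hdeg i hi, hcoins i hi]
  | succ r ih =>
    intro hr i hi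
    have ih := ih (by omega)
    simp only [state]
    by_cases hc : (r : ℕ∞) < E.crashRound i
    · rw [if_pos hc, if_pos ((hcrash r hr i hi).1 hc), ih i hi]
      congr 1
      funext j
      by_cases hj : j = i
      · simp [hj]
      · obtain ⟨h1, h2⟩ := hdel r hr i hi hc j hj
        by_cases hd : E.Delivers r j i
        · rw [if_pos ⟨hj, hd⟩, if_pos ⟨hj, h1.1 hd⟩]
          by_cases hjD : j ∈ D
          · rw [h2 hd hjD]
          · rw [ih j hjD]
        · rw [if_neg (fun h => hd h.2), if_neg (fun h => hd (h1.2 h.2))]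
    · rw [if_neg hc, if_neg (fun h => hc ((hcrash r hr i hi).2 h)), ih i hi]

/-- A crash in round `k` has no effect on the states after at most `k` rounds. -/
lemma state_crash (A : Algorithm n b) {E : Scenario n} {p : Fin n} (hp : p ∉ E.faulty) (k : ℕ)
    (R : Set (Fin n)) {r : ℕ} (hr : r ≤ k) (i : Fin n) :
    A.state (E.crash p k R) r i = A.state E r i := by
  have htop := Scenario.crashRound_eq_top hp
  refine (A.state_congr ∅ k ?_ ?_ ?_ ?_) r hr i (by simp)
  · intros; rfl
  · intros; rfl
  · intro r hr i _
    by_cases hi : i = p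
    · subst hi
      rw [Scenario.crash_crashRound_self, htop]
      simp [hr]
    · rw [Scenario.crash_crashRound_of_ne _ hi]
  · intro r hr i _ _ j _
    refine ⟨?_, by simp⟩
    by_cases hj : j = p
    · subst hj
      rw [Scenario.delivers_crash_self]
      simp [Scenario.Delivers, htop, hr]
    · rw [Scenario.delivers_crash_of_ne _ hj]

/-- Crashing at the start of round `k + 1` or at the end of round `k` makes no difference to the
other nodes. -/
lemma state_crash_succ_empty (A : Algorithm n b) {E : Scenario n} {p : Fin n} (hp : p ∉ E.faulty)
    (k r : ℕ) {i : Fin n} (hi : i ≠ p) :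
    A.state (E.crash p (k + 1) ∅) r i = A.state (E.crash p k Set.univ) r i := by
  refine (A.state_congr {p} r ?_ ?_ ?_ ?_) r le_rfl i (by simpa using hi)
  · intros; rfl
  · intros; rfl
  · intro r _ i hi
    rw [Scenario.crash_crashRound_of_ne _ hi, Scenario.crash_crashRound_of_ne _ hi]
  · intro r _ i _ _ j _
    by_cases hj : j = p
    · subst hj
      rw [Scenario.delivers_crash_self, Scenario.delivers_crash_self]
      simp only [Set.mem_empty_iff_false, and_false, or_false, Set.mem_univ, and_true]
      -- A delivered message has r ≤ k, and up to then neither crash has affected the state of the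
      -- sender.
      refine ⟨by omega, fun h _ => ?_⟩
      rw [A.state_crash hp _ _ (by omega), A.state_crash hp _ _ (by omega)]
    · rw [Scenario.delivers_crash_of_ne _ hj, Scenario.delivers_crash_of_ne _ hj]
      exact ⟨Iff.rfl, fun _ h => absurd h hj⟩

/-- Whether the last message of `p` reaches a node that is inactive afterwards makes no difference
to the others. -/
lemma state_crash_insert_crash (A : Algorithm n b) {E : Scenario n} {p q : Fin n}
    (hp : p ∉ E.faulty) (hq : q ∉ E.faulty) (hqp : q ≠ p) (k r : ℕ) (R : Set (Fin n))
    {i : Fin n} (hi : i ≠ q) :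
    A.state ((E.crash p k R).crash q (k + 1) ∅) r i =
      A.state ((E.crash p k (insert q R)).crash q (k + 1) ∅) r i := by
  have hq' : ∀ R, q ∉ (E.crash p k R).faulty := fun R => by
    rw [Scenario.faulty_crash]; simp [hqp, hq]
  refine (A.state_congr {q} r ?_ ?_ ?_ ?_) r le_rfl i (by simpa using hi)
  · intros; rfl
  · intros; rfl
  · intro r _ i hi
    rw [Scenario.crash_crashRound_of_ne _ hi, Scenario.crash_crashRound_of_ne _ hi]
    rfl
  · intro r _ i hi _ j _
    have hi : i ≠ q := hi
    by_cases hj : j = q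
    · subst hj
      rw [Scenario.delivers_crash_self, Scenario.delivers_crash_self]
      simp only [Set.mem_empty_iff_false, and_false, or_false, true_and]
      intro h _
      rw [A.state_crash (hq' _) _ _ (by omega), A.state_crash (hq' _) _ _ (by omega),
        A.state_crash hp _ _ (by omega), A.state_crash hp _ _ (by omega)]
    · rw [Scenario.delivers_crash_of_ne _ hj, Scenario.delivers_crash_of_ne _ hj]
      refine ⟨?_, fun _ h => absurd h hj⟩
      by_cases hjp : j = p
      · subst hjp
        rw [Scenario.delivers_crash_self, Scenario.delivers_crash_self]
        simp [hi]
      · rw [Scenario.delivers_crash_of_ne _ hjp, Scenario.delivers_crash_of_ne _ hjp]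

/-- Messages sent in round `k` to a node that crashes by then are immaterial. -/
lemma state_crash_insert (A : Algorithm n b) {E : Scenario n} {p q : Fin n} (k r : ℕ)
    (R : Set (Fin n)) (hq : (E.crash p k R).crashRound q ≤ k) (i : Fin n) :
    A.state (E.crash p k R) r i = A.state (E.crash p k (insert q R)) r i := by
  refine (A.state_congr ∅ r ?_ ?_ ?_ ?_) r le_rfl i (by simp)
  · intros; rfl
  · intros; rfl
  · intros; rfl
  · intro r _ i _ hr j _
    refine ⟨?_, by simp⟩
    by_cases hjp : j = p
    · subst hjp
      rw [Scenario.delivers_crash_self, Scenario.delivers_crash_self]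
      by_cases hiq : i = q
      · subst hiq
        -- An active q is still before round k, where membership in R plays no role.
        have : r < k := by exact_mod_cast hr.trans_le hq
        simp [this]
      · simp [hiq]
    · rw [Scenario.delivers_crash_of_ne _ hjp, Scenario.delivers_crash_of_ne _ hjp]

/-- The input of a node that crashes before it sends anything is immaterial to the others. -/
lemma state_crash_zero_empty (A : Algorithm n b) {E E' : Scenario n} {p : Fin n}
    (hdeg : ∀ i, i ≠ p → E.deg i = E'.deg i) (hcoins : E.coins = E'.coins)
    (hcrash : E.crashRound = E'.crashRound) (hreached : E.reached = E'.reached)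
    (r : ℕ) {i : Fin n} (hi : i ≠ p) :
    A.state (E.crash p 0 ∅) r i = A.state (E'.crash p 0 ∅) r i := by
  refine (A.state_congr (E := E.crash p 0 ∅) (E' := E'.crash p 0 ∅) {p} r hdeg ?_ ?_ ?_) r le_rfl i (by simpa using hi)
  · intro i _; exact congrFun hcoins i
  · intro r _ i hi
    rw [Scenario.crash_crashRound_of_ne _ hi, Scenario.crash_crashRound_of_ne _ hi, hcrash]
  · intro r _ i _ _ j _
    by_cases hj : j = p
    · subst hj
      simp [Scenario.delivers_crash_self]
    · rw [Scenario.delivers_crash_of_ne _ hj, Scenario.delivers_crash_of_ne _ hj]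
      exact ⟨by simp [Scenario.Delivers, hcrash, hreached], fun _ h => absurd h hj⟩

/-! ### The chain argument -/

/-- `V` takes the same value on any two executions with at most `f` crashes that some non-faulty
node cannot tell apart within `t` rounds. -/
def Respects (A : Algorithm n b) (f t : ℕ) (V : Scenario n → Prop) : Prop :=
  ∀ E E' : Scenario n, E.Admissible f → E'.Admissible f → ∀ i, i ∉ E.faulty → i ∉ E'.faulty →
    A.state E t i = A.state E' t i → (V E ↔ V E')

/-- Since f < n, some node survives in E', hence also in E, and serves as the witness. -/
lemma Respects.iff {A : Algorithm n b} {f t : ℕ} {V : Scenario n → Prop} (hV : A.Respects f t V)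
    (hf : f < n) {E E' : Scenario n} (hdeg : ∀ i, E.deg i < n) (hdeg' : ∀ i, E'.deg i < n)
    (hsub : E.faulty ⊆ E'.faulty) (hcard : E'.faulty.ncard ≤ f)
    (hstate : ∀ i, i ∉ E'.faulty → A.state E t i = A.state E' t i) : V E ↔ V E' := by
  obtain ⟨i, hi⟩ : ∃ i, i ∉ E'.faulty := by
    by_contra! h
    rw [Set.eq_univ_of_forall h, Set.ncard_univ, Nat.card_fin] at hcard
    omega
  exact hV E E' ⟨(Set.ncard_le_ncard hsub).trans hcard, hdeg⟩ ⟨hcard, hdeg'⟩ i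
    (fun h => hi (hsub h)) hi (hstate i hi)

/-- The chain argument: silencing one more node from round `k` on does not change the value of
`V`. -/
lemma Respects.crash_iff {A : Algorithm n b} {f t : ℕ} {V : Scenario n → Prop}
    (hV : A.Respects f t V) (hf : f < n) (htf : t + 1 ≤ f) {k : ℕ} (hk : k ≤ t) :
    ∀ E : Scenario n, (∀ i, E.deg i < n) → E.CrashesBefore k → ∀ p, p ∉ E.faulty →
      (V E ↔ V (E.crash p k ∅)) := by
  induction hk using Nat.decreasingInduction with
  | self =>
    intro E hdeg hE p hp
    refine hV.iff hf hdeg hdeg ?_ ?_ fun i _ => (A.state_crash hp t ∅ le_rfl i).symm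
    · rw [Scenario.faulty_crash]; exact Set.subset_insert _ _
    · exact (hE.crash p ∅).1.trans htf
  | of_succ k hk ih =>
    intro E hdeg hE p hp
    have hcard : ∀ R, (E.crash p k R).faulty.ncard ≤ k + 1 := fun R => (hE.crash p R).1
    have hdrop : ∀ R q, V (E.crash p k R) ↔ V (E.crash p k (insert q R)) := by
      intro R q
      by_cases hq : q ∈ (E.crash p k R).faulty
      · refine hV.iff hf hdeg hdeg ?_ ((hcard _).trans (by omega)) fun i _ =>
          A.state_crash_insert k t R ?_ i
        · rw [Scenario.faulty_crash, Scenario.faulty_crash]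
        · exact Order.le_of_lt_add_one (by exact_mod_cast (hE.crash p R).2 q hq)
      · have hq' : q ∉ (E.crash p k (insert q R)).faulty := by
          rwa [Scenario.faulty_crash] at hq ⊢
        -- Silence q from round k + 1 on in both executions. This makes at most k + 2 crashes,
        -- within f because k < t.
        rw [ih (E.crash p k R) hdeg (hE.crash p R) q hq,
          ih (E.crash p k (insert q R)) hdeg (hE.crash p (insert q R)) q hq']
        rw [Scenario.faulty_crash, Set.mem_insert_iff, not_or] at hq
        refine hV.iff hf hdeg hdeg ?_ ?_ fun i hi =>
          A.state_crash_insert_crash hp hq.2 hq.1 k t R ?_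
        · simp only [Scenario.faulty_crash]; exact subset_rfl
        · exact ((hE.crash p (insert q R)).crash q ∅).1.trans (by omega)
        · rintro rfl
          simp [Scenario.faulty_crash] at hi
    have hall : V (E.crash p k ∅) ↔ V (E.crash p k Set.univ) := by
      refine Set.Finite.induction_on (motive := fun R _ => V (E.crash p k ∅) ↔ V (E.crash p k R))
        _ Set.finite_univ Iff.rfl fun {q R} _ _ h => h.trans (hdrop R q)
    -- What remains compares silence from round k + 1 on with a crash in round k after all messages
    -- arrived.
    rw [hall, ih E hdeg hE.succ p hp]
    refine hV.iff hf hdeg hdeg ?_ ((hcard _).trans (by omega)) fun i hi =>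
      A.state_crash_succ_empty hp k t ?_
    · rw [Scenario.faulty_crash, Scenario.faulty_crash]
    · rintro rfl
      simp [Scenario.faulty_crash] at hi

/-! ### Verdicts and the two inputs -/

lemma out_mono (A : Algorithm n b) (E : Scenario n) (i : Fin n) {o : Output n} {r s : ℕ}
    (hrs : r ≤ s) (h : A.out i (A.state E r i) = some o) : A.out i (A.state E s i) = some o := by
  induction s, hrs using Nat.le_induction with
  | base => exact h
  | succ s _ ih =>
    simp only [state]
    split_ifs
    · exact A.out_step _ _ _ _ ih
    · exact ih

lemma TerminatesWithin.mono {A : Algorithm n b} {E : Scenario n} {r s : ℕ} (hrs : r ≤ s)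
    (h : A.TerminatesWithin E r) : A.TerminatesWithin E s := fun i hi =>
  (h i hi).imp fun _ => A.out_mono E i hrs

/-- The output of a node that has terminated is its output at all times. -/
lemma Outputs.out_eq {A : Algorithm n b} {E : Scenario n} {i : Fin n} {o : Output n} {t : ℕ}
    (h : A.Outputs E i o) (ht : ∃ o, A.out i (A.state E t i) = some o) :
    A.out i (A.state E t i) = some o := by
  obtain ⟨r, hr⟩ := h
  obtain ⟨o', ho'⟩ := ht
  have h1 := A.out_mono E i (le_max_left r t) hr
  have h2 := A.out_mono E i (le_max_right r t) ho'
  rw [h1] at h2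
  rw [ho', h2]

/-- The non-faulty nodes agree on whether the degrees are realizable. -/
lemma Solves.respects {A : Algorithm n b} {f t : ℕ} (hA : A.Solves f)
    (ht : ∀ E : Scenario n, E.Admissible f → A.TerminatesWithin E t) :
    A.Respects f t fun E => ∀ i, i ∉ E.faulty → A.Outputs E i .unrealizable := by
  have key : ∀ E : Scenario n, E.Admissible f → ∀ i, i ∉ E.faulty →
      ((∀ j, j ∉ E.faulty → A.Outputs E j .unrealizable) ↔
        A.out i (A.state E t i) = some .unrealizable) := by
    intro E hE i hi
    refine ⟨fun h => (h i hi).out_eq (ht E hE i hi), fun h => ?_⟩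
    -- Correctness excludes mixed verdicts, so the output of the single node i decides.
    obtain ⟨S, -, -, ⟨G, -, hG, -⟩ | ⟨-, hS⟩⟩ := (hA E hE).2
    · obtain ⟨K, hK, -⟩ := hG i hi
      have := hK.out_eq (ht E hE i hi)
      rw [h] at this
      cases this
    · exact hS
  intro E E' hE hE' i hi hi' h
  exact (key E hE i hi).trans (h ▸ (key E' hE' i hi').symm)

end Algorithm

lemma realizable_zero (S : Set (Fin n)) : Realizable (fun _ => 0) S :=
  ⟨⊥, by simp [IsRealization, SimpleGraph.neighborSet]⟩

/-- The neighbour of p would have prescribed degree 0. -/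
lemma not_realizable_single (p : Fin n) : ¬ Realizable (Pi.single p 1) Set.univ := by
  rintro ⟨G, -, hG⟩
  have hp := hG p trivial
  rw [Pi.single_eq_same] at hp
  obtain ⟨q, hq⟩ := Set.nonempty_of_ncard_ne_zero (by rw [hp]; exact one_ne_zero)
  have hq0 := hG q trivial
  rw [Pi.single_eq_of_ne (G.ne_of_adj hq).symm, Set.ncard_eq_zero] at hq0
  exact Set.eq_empty_iff_forall_notMem.1 hq0 p (G.adj_symm hq)

/-- The execution without crashes on given degrees, all coins showing `false`. -/
def Scenario.faultFree (d : Fin n → ℕ) : Scenario n where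
  deg := d
  coins _ _ := false
  crashRound _ := ⊤
  reached _ := ∅

lemma Scenario.faulty_faultFree (d : Fin n → ℕ) : (faultFree d).faulty = ∅ := by
  simp [faulty, faultFree]

lemma Scenario.crashesBefore_faultFree (d : Fin n → ℕ) : (faultFree d).CrashesBefore 0 := by
  simp [CrashesBefore, faulty_faultFree]

lemma Scenario.admissible_faultFree {d : Fin n → ℕ} (hd : ∀ i, d i < n) (f : ℕ) :
    (faultFree d).Admissible f :=
  ⟨by simp [faulty_faultFree], hd⟩

/-- Without crashes, the verdict is "unrealizable" exactly on unrealizable degrees. -/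
lemma Algorithm.Solves.faultFree_iff {A : Algorithm n b} {f : ℕ} (hA : A.Solves f)
    {d : Fin n → ℕ} (hd : ∀ i, d i < n) (p : Fin n) :
    (∀ i, i ∉ (Scenario.faultFree d).faulty →
      A.Outputs (Scenario.faultFree d) i .unrealizable) ↔ ¬ Realizable d Set.univ := by
  have hp : p ∉ (Scenario.faultFree d).faulty := by simp [Scenario.faulty_faultFree]
  obtain ⟨⟨r, hr⟩, S, -, hS, h⟩ := hA _ (Scenario.admissible_faultFree hd f)
  rw [Scenario.faulty_faultFree, Set.subset_empty_iff, Set.compl_empty_iff] at hS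
  subst hS
  obtain ⟨G, hG, hout, -⟩ | ⟨hn, hout⟩ := h
  · refine iff_of_false (fun h => ?_) (not_not.2 ⟨G, hG⟩)
    obtain ⟨K, hK, -⟩ := hout p hp
    have h1 := hK.out_eq (hr p hp)
    rw [(h p hp).out_eq (hr p hp)] at h1
    cases h1
  · exact iff_of_true hout hn

/-- An algorithm that tolerates `f` crashes does not always terminate within fewer than `f`
rounds. -/
lemma Algorithm.Solves.exists_not_terminatesWithin {A : Algorithm n b} {f t : ℕ}
    (hA : A.Solves f) (hf : f < n) (htf : t + 1 ≤ f) :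
    ∃ E : Scenario n, E.Admissible f ∧ ¬ A.TerminatesWithin E t := by
  by_contra! ht
  have hV := hA.respects ht
  let p : Fin n := ⟨0, by omega⟩
  have hd0 : ∀ i : Fin n, (fun _ : Fin n => 0) i < n := fun _ => by simp; omega
  -- Degree 1 is a legal input because 1 ≤ f < n.
  have hd1 : ∀ i : Fin n, (Pi.single p 1 : Fin n → ℕ) i < n := fun i => by
    rw [Pi.single_apply]; split_ifs <;> omega
  have hp : ∀ d, p ∉ (Scenario.faultFree d).faulty := fun d => by
    simp [Scenario.faulty_faultFree]
  have h0 := hV.crash_iff hf htf t.zero_le (.faultFree fun _ => 0) hd0 (Scenario.crashesBefore_faultFree _) p (hp _)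
  have h1 := hV.crash_iff hf htf t.zero_le (.faultFree (Pi.single p 1)) hd1 (Scenario.crashesBefore_faultFree _) p (hp _)
  have h01 := hV.iff hf (E := (Scenario.faultFree fun _ => 0).crash p 0 ∅)
    (E' := (Scenario.faultFree (Pi.single p 1)).crash p 0 ∅) hd0 hd1
    (by simp [Scenario.faulty_crash, Scenario.faulty_faultFree])
    (by simp [Scenario.faulty_crash, Scenario.faulty_faultFree]; omega)
    (fun i hi => A.state_crash_zero_empty (E := .faultFree fun _ => 0)
      (E' := .faultFree (Pi.single p 1)) (p := p)
      (fun i hi => (Pi.single_eq_of_ne (M := fun _ => ℕ) hi 1).symm) rfl rfl rfl t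
      (fun h => hi (by simp [Scenario.faulty_crash, h])))
  have h := h0.trans (h01.trans h1.symm)
  rw [hA.faultFree_iff hd0 p, hA.faultFree_iff hd1 p] at h
  exact h.2 (not_realizable_single p) (realizable_zero _)

end CrashClique

theorem mainTheorem2 :
    ∃ c : ℝ, 0 < c ∧
      ∀ (n f b : ℕ), f < n →
        ∀ A : CrashClique.Algorithm n b, A.Solves f →
          ∃ E : CrashClique.Scenario n, E.Admissible f ∧
            ∀ r : ℕ, A.TerminatesWithin E r → c * (f : ℝ) ≤ (r : ℝ) := by
  refine ⟨1, one_pos, fun n f b hf A hA => ?_⟩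
  obtain rfl | hf0 := Nat.eq_zero_or_pos f
  · exact ⟨.faultFree fun _ => 0, CrashClique.Scenario.admissible_faultFree (fun _ => hf) 0,
      fun r _ => by simp⟩
  · obtain ⟨E, hE, hE'⟩ := hA.exists_not_terminatesWithin hf (t := f - 1) (by omega)
    refine ⟨E, hE, fun r hr => ?_⟩
    rw [one_mul, Nat.cast_le]
    by_contra! hlt
    exact hE' (hr.mono (by omega))
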